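/- There is an absolute constant $C$ such that for every finite vertex set $V$, with $n=|V|$, there is a randomized adaptive query algorithm with the following property. Let $G=(V,w)$ be any weighted graph on $V$, that is, $w$ assigns a real weight $w(e)\ge 0$ to every 2-element subset $e$ of $V$, and the edges of $G$ are the $e$ with $w(e)>0$. Let $A\in\mathbb{R}^{V\times V}$ be its adjacency matrix: $A(u,v)=w(\{u,v\})$ for $u\ne v$ and $A(u,u)=0$. The algorithm knows $V$, and has access to $G$ only through queries of the following form: it chooses $v\in\{0,1\}^V$, possibly depending on the previous answers and on its internal randomness, and receives the vector $[Av]_{>0}\circ(1-v)\in\{0,1\}^V$, whose $i$-th entry is $1$ if $(Av)_i>0$ and $v_i=0$, and is $0$ otherwise. Then, on every such $G$, the algorithm always makes at most $C\log(n)^4$ queries, and with probability at least $4/5$ it outputs a spanning forest of $G$, i.e. a set of edges of $G$ that contains no cycle and has the same connected components on $V$ as $G$. (Here $\log 0$ is read as $0$, so for $n\le 1$ no queries are made.) -/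

import Mathlib

universe u

/-- An undirected weighted graph `(V, w)`: a nonnegative weight for each 2-element subset of `V`
(a non-diagonal unordered pair). -/
structure WeightedGraph (V : Type u) where
  w : {e : Sym2 V // ¬ e.IsDiag} → ℝ
  nonneg : ∀ e, 0 ≤ w e

namespace WeightedGraph

variable {V : Type u}

/-- The set of edges: the 2-element subsets of positive weight. -/
def edges (G : WeightedGraph V) : Set (Sym2 V) :=
  {e | ∃ h : ¬ e.IsDiag, 0 < G.w ⟨e, h⟩}

/-- The underlying simple graph `(V, E(G))`. -/
def toSimpleGraph (G : WeightedGraph V) : SimpleGraph V :=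
  SimpleGraph.fromEdgeSet G.edges

/-- The weighted adjacency matrix, with zero diagonal. -/
def adjMatrix [DecidableEq V] (G : WeightedGraph V) : Matrix V V ℝ :=
  Matrix.of fun i j => if h : i = j then 0 else G.w ⟨s(i, j), by simpa using h⟩

/-- `F` is (the edge set of) a spanning forest of `G`: it consists of edges of `G`, contains no
cycle, and has the same connected components as `G`. -/
def IsSpanningForest (G : WeightedGraph V) (F : Finset (Sym2 V)) : Prop :=
  (F : Set (Sym2 V)) ⊆ G.edges ∧
  (SimpleGraph.fromEdgeSet (F : Set (Sym2 V))).IsAcyclic ∧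
  ∀ a b : V, (SimpleGraph.fromEdgeSet (F : Set (Sym2 V))).Reachable a b ↔
    G.toSimpleGraph.Reachable a b

end WeightedGraph

/-- The real vector of a Boolean vector in `{0,1}^V`. -/
def boolVec {V : Type u} (v : V → Bool) : V → ℝ := fun j => if v j then 1 else 0

/-- The answer `[A v]_{>0} ∘ (1 - v)` to the master model query `v`: coordinate `i` is `1` iff
`(A v)_i > 0` and `v_i = 0`. -/
noncomputable def masterAnswer {V : Type u} [Fintype V] (A : Matrix V V ℝ) (v : V → Bool) :
    V → Bool :=
  fun i => decide (0 < A.mulVec (boolVec v) i) && !(v i)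

/-- A deterministic adaptive query algorithm (decision tree) whose queries and answers are
vectors in `{0,1}^V` and whose output is of type `O`. At each step it either stops with an output,
or makes a query and continues depending on the answer. -/
inductive QueryAlg (V : Type u) (O : Type u) : Type u where
  | output (o : O) : QueryAlg V O
  | query (v : V → Bool) (next : (V → Bool) → QueryAlg V O) : QueryAlg V O

namespace QueryAlg

variable {V O : Type u}

/-- The output of the algorithm when the query `v` is answered by `oracle v`. -/
def run (oracle : (V → Bool) → (V → Bool)) : QueryAlg V O → O
  | output o => o
  | query v next => run oracle (next (oracle v))

/-- The number of queries made when the query `v` is answered by `oracle v`. -/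
def numQueries (oracle : (V → Bool) → (V → Bool)) : QueryAlg V O → ℕ
  | output _ => 0
  | query v next => numQueries oracle (next (oracle v)) + 1

end QueryAlg

/-- A randomized query algorithm: a probability distribution on deterministic ones. -/
abbrev RandQueryAlg (V : Type u) (O : Type u) : Type u := PMF (QueryAlg V O)

namespace RandQueryAlg

variable {V O : Type u}

/-- The probability that the output satisfies `p` when queries are answered by `oracle`. -/
noncomputable def prob (P : RandQueryAlg V O) (oracle : (V → Bool) → (V → Bool))
    (p : O → Prop) : ENNReal :=
  PMF.toOuterMeasure P {T | p (T.run oracle)}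

/-- With every outcome of its randomness, the algorithm makes at most `q` queries when they are
answered by `oracle`. -/
def MakesAtMost (P : RandQueryAlg V O) (oracle : (V → Bool) → (V → Bool)) (q : ℝ) : Prop :=
  ∀ T ∈ PMF.support P, (T.numQueries oracle : ℝ) ≤ q

end RandQueryAlg

/-!
The algorithm is Borůvka's, with star contraction. It maintains a graph `H ≤ G` of known edges. A
component of `H` is active if an edge of `G` leaves it; once no component is active, `H` and `G`
have the same components, and a spanning forest of `H` is returned.

In a round, with `2 ^ L ≥ n`, each component of `H` gets a random colour, and each vertex a random
hash value below `2 ^ (L + 1)`. The `j`-th sample consists of the vertices of coloured components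
with hash value below `2 ^ j`. For each sample and each of the `L` bits of the vertex names, the
algorithm queries the part of the sample where this bit is `0` and the part where it is `1`. A
vertex `v` of an uncoloured component lies in no query, so the answers at `v` tell which bit values
occur among its neighbours in the sample. If every bit takes exactly one value, `v` has exactly one
neighbour there and has learnt its name. Hence only true edges are ever added (`Finds.adj`), and the
edge is added whenever `v` has a unique neighbour in some sample (`finds_of_unique`).

An active component is uncoloured, with a fixed neighbouring component coloured, with probability
`1 / 4`; then one of the sampling rates isolates a neighbour with probability at least `1 / 8`
(`exists_level_card_le_eight_mul`, a second moment bound using pairwise independence only). So each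
active component is attached to a coloured one with probability at least `1 / 32`
(`card_seed_le_card_filter_mem_attached`). Each active component after the round contains an active
one that was not attached (`card_activeComponents_le`), so the expected number of active components
drops by the factor `31 / 32` (`sum_card_activeComponents_nextGraph_le`). After `96 L` rounds it is
at most `1 / 5`, which bounds the failure probability (`toOuterMeasure_forestAlg_le`). The number of
queries is `96 L * (L + 1) * 2 L`, which is even `O(log(n) ^ 3)`.
-/

/-! ### Pairwise independence and isolation -/

open Finset in
/-- A uniformly random function `V → α` takes a value in `A` at `x` with probability
`#A / #α`. -/
theorem card_filter_apply_mem {V α : Type*} [Fintype V] [DecidableEq V] [Fintype α]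
    [DecidableEq α] (x : V) (A : Finset α) :
    #{h : V → α | h x ∈ A} * Fintype.card α = #A * Fintype.card (V → α) := by
  have hpi : ({h : V → α | h x ∈ A} : Finset (V → α)) =
      Fintype.piFinset fun z => if z = x then A else univ := by
    ext h
    simp only [mem_filter, mem_univ, true_and, Fintype.mem_piFinset]
    refine ⟨fun hx z => ?_, fun hz => by simpa using hz x⟩
    split_ifs with hzx
    · exact hzx ▸ hx
    · exact mem_univ _
  have hprod : ∏ z : V, (#(if z = x then A else univ) * if z = x then Fintype.card α else 1) =
      ∏ z : V, ((if z = x then #A else 1) * Fintype.card α) := by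
    refine prod_congr rfl fun z _ => ?_
    split_ifs <;> simp
  simp only [prod_mul_distrib, prod_ite_eq', mem_univ, if_true, prod_const] at hprod
  rw [hpi, Fintype.card_piFinset, Fintype.card_fun, hprod, card_univ]

open Finset in
/-- The values of a uniformly random function `V → α` at two distinct points are independent. -/
theorem card_filter_apply_mem_and_apply_mem {V α : Type*} [Fintype V] [DecidableEq V]
    [Fintype α] [DecidableEq α] {x y : V} (hxy : x ≠ y) (A B : Finset α) :
    #{h : V → α | h x ∈ A ∧ h y ∈ B} * Fintype.card α ^ 2 =
      #A * #B * Fintype.card (V → α) := by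
  have hpi : ({h : V → α | h x ∈ A ∧ h y ∈ B} : Finset (V → α)) =
      Fintype.piFinset fun z => if z = x then A else if z = y then B else univ := by
    ext h
    simp only [mem_filter, mem_univ, true_and, Fintype.mem_piFinset]
    refine ⟨fun hh z => ?_, fun hz => ⟨by simpa using hz x, by simpa [hxy.symm] using hz y⟩⟩
    split_ifs with hzx hzy
    · exact hzx ▸ hh.1
    · exact hzy ▸ hh.2
    · exact mem_univ _
  have hprod : ∏ z : V, (#(if z = x then A else if z = y then B else univ) *
        (if z = x then Fintype.card α else 1) * if z = y then Fintype.card α else 1) =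
      ∏ z : V, ((if z = x then #A else 1) * (if z = y then #B else 1) * Fintype.card α) := by
    refine prod_congr rfl fun z _ => ?_
    split_ifs with hzx hzy
    · exact absurd (hzx.symm.trans hzy) hxy
    all_goals simp
  simp only [prod_mul_distrib, prod_ite_eq', mem_univ, if_true, prod_const] at hprod
  rw [hpi, Fintype.card_piFinset, Fintype.card_fun, sq, ← mul_assoc, hprod, card_univ]

open Finset in
/-- Isolation: for a set `N` whose size is within a factor two of `m / (2 k)`, a random function
`V → Fin m` sends exactly one point of `N` below `k` with probability at least `1 / 8`. With `X`
the number of points of `N` sent below `k`, the indicator of `X = 1` is at least `2 X - X²`, and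
the first two moments of `X` only involve pairs of points. -/
theorem card_le_eight_mul_card_filter_card_eq_one {V : Type*} [Fintype V] [DecidableEq V]
    (N : Finset V) {m k : ℕ} (hm : 0 < m) (hkm : k ≤ m) (hle : 2 * (#N * k) ≤ m)
    (hge : m ≤ 4 * (#N * k)) :
    Fintype.card (V → Fin m) ≤
      8 * #{h : V → Fin m | #{u ∈ N | (h u : ℕ) < k} = 1} := by
  set M : ℝ := ((Fintype.card (V → Fin m) : ℕ) : ℝ) with hM
  have hM0 : 0 ≤ M := by positivity
  have hm0 : (0 : ℝ) < m := by exact_mod_cast hm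
  set p : ℝ := k / m with hp
  have hcard : #{a : Fin m | (a : ℕ) < k} = k := by
    rw [Fin.card_filter_val_lt]; exact min_eq_right hkm
  let X : (V → Fin m) → V → ℝ := fun h u => if (h u : ℕ) < k then 1 else 0
  have hfirst (u : V) : ∑ h, X h u = p * M := by
    have := card_filter_apply_mem (α := Fin m) u {a | (a : ℕ) < k}
    rw [hcard, Fintype.card_fin] at this
    simp only [mem_filter, mem_univ, true_and] at this
    have hR : (#{h : V → Fin m | (h u : ℕ) < k} : ℝ) * m = k * M := by
      rw [hM]; exact_mod_cast this
    simp only [X, sum_boole, hp]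
    field_simp
    linarith
  have hsecond (u v : V) (huv : u ≠ v) : ∑ h, X h u * X h v = p ^ 2 * M := by
    have := card_filter_apply_mem_and_apply_mem (α := Fin m) huv {a | (a : ℕ) < k}
      {a | (a : ℕ) < k}
    rw [hcard, Fintype.card_fin] at this
    simp only [mem_filter, mem_univ, true_and] at this
    have hR : (#{h : V → Fin m | (h u : ℕ) < k ∧ (h v : ℕ) < k} : ℝ) * m ^ 2 = k * k * M := by
      rw [hM]; exact_mod_cast this
    have hX (h : V → Fin m) :
        X h u * X h v = if (h u : ℕ) < k ∧ (h v : ℕ) < k then 1 else 0 := by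
      simp only [X, ite_and]; split_ifs <;> simp
    simp only [hX, sum_boole, hp]
    field_simp
    linarith
  have hdiag (u : V) : ∑ h, X h u * X h u = p * M := by
    rw [← hfirst u]
    refine sum_congr rfl fun h _ => ?_
    simp only [X]; split_ifs <;> simp
  set d : ℝ := ((#N : ℕ) : ℝ) with hd
  have hsumX : ∑ h, ∑ u ∈ N, X h u = d * (p * M) := by
    rw [sum_comm, sum_congr rfl fun u _ => hfirst u, sum_const, nsmul_eq_mul]
  have hsumXX : ∑ h, (∑ u ∈ N, X h u) ^ 2 ≤ d * (p * M) + d ^ 2 * (p ^ 2 * M) := by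
    have hexp : ∑ h, (∑ u ∈ N, X h u) ^ 2 = ∑ u ∈ N, ∑ v ∈ N, ∑ h, X h u * X h v := by
      simp only [sq, sum_mul_sum]
      rw [sum_comm]
      exact sum_congr rfl fun u _ => sum_comm
    have hentry : ∀ u ∈ N, ∀ v ∈ N,
        ∑ h, X h u * X h v ≤ (if u = v then p * M else 0) + p ^ 2 * M := by
      intro u _ v _
      by_cases huv : u = v
      · subst huv
        rw [hdiag, if_pos rfl]
        have : 0 ≤ p ^ 2 * M := by positivity
        linarith
      · rw [hsecond u v huv, if_neg huv, zero_add]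
    rw [hexp]
    refine (sum_le_sum fun u hu => sum_le_sum (hentry u hu)).trans (le_of_eq ?_)
    simp only [sum_add_distrib, sum_ite_eq, sum_const, nsmul_eq_mul, ← hd]
    rw [sum_ite_mem, inter_self, sum_const, nsmul_eq_mul]
    ring
  have hpoint (h : V → Fin m) : 2 * ∑ u ∈ N, X h u - (∑ u ∈ N, X h u) ^ 2 ≤
      if #{u ∈ N | (h u : ℕ) < k} = 1 then 1 else 0 := by
    simp only [X, sum_boole]
    split_ifs with h1
    · rw [h1]; norm_num
    · rcases Nat.lt_or_gt_of_ne h1 with h0 | h2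
      · rw [Nat.lt_one_iff.1 h0]; norm_num
      · have : (2 : ℝ) ≤ #{u ∈ N | (h u : ℕ) < k} := by exact_mod_cast h2
        nlinarith
  have htotal := sum_le_sum fun h (_ : h ∈ univ) => hpoint h
  rw [sum_sub_distrib, ← mul_sum, hsumX, sum_boole] at htotal
  have hlo : 1 / 4 ≤ d * p := by
    rw [hp, ← mul_div_assoc, le_div_iff₀ hm0]
    have : (m : ℝ) ≤ 4 * (d * k) := by rw [hd]; exact_mod_cast hge
    linarith
  have hhi : d * p ≤ 1 / 2 := by
    rw [hp, ← mul_div_assoc, div_le_iff₀ hm0]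
    have : 2 * (d * k) ≤ (m : ℝ) := by rw [hd]; exact_mod_cast hle
    linarith
  have hkey : 1 / 8 ≤ d * p - (d * p) ^ 2 := by nlinarith
  have hfin : M ≤ 8 * (#{h : V → Fin m | #{u ∈ N | (h u : ℕ) < k} = 1} : ℝ) := by
    nlinarith [mul_le_mul_of_nonneg_right hkey hM0]
  rw [hM] at hfin
  exact_mod_cast hfin

open Finset in
/-- One of the sampling rates `2 ^ j / 2 ^ (L + 1)`, `j ≤ L`, fits a given nonempty set of at most
`2 ^ L` points. -/
theorem exists_level_card_le_eight_mul {V : Type*} [Fintype V] [DecidableEq V] (N : Finset V)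
    {L : ℕ} (hN : N.Nonempty) (hL : #N ≤ 2 ^ L) :
    ∃ j : Fin (L + 1), Fintype.card (V → Fin (2 ^ (L + 1))) ≤
      8 * #{h : V → Fin (2 ^ (L + 1)) | #{u ∈ N | (h u : ℕ) < 2 ^ (j : ℕ)} = 1} := by
  have hc : Nat.clog 2 #N ≤ L := Nat.clog_le_of_le_pow hL
  have hup : #N ≤ 2 ^ Nat.clog 2 #N := Nat.le_pow_clog one_lt_two _
  have hlow : 2 ^ Nat.clog 2 #N ≤ 2 * #N := by
    rcases Nat.eq_or_lt_of_le hN.card_pos with h1 | h1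
    · rw [← h1]; simp
    · have hpos : 0 < Nat.clog 2 #N := Nat.clog_pos one_lt_two h1
      have hpred := Nat.pow_pred_clog_lt_self one_lt_two h1
      obtain ⟨c, hcc⟩ := Nat.exists_eq_succ_of_ne_zero hpos.ne'
      rw [hcc] at hpred ⊢
      rw [Nat.succ_eq_add_one, pow_succ]
      simp only [Nat.pred_succ] at hpred
      omega
  have hsplit : (2 : ℕ) ^ (L + 1) = 2 * (2 ^ Nat.clog 2 #N * 2 ^ (L - Nat.clog 2 #N)) := by
    rw [← pow_add, Nat.add_sub_cancel' hc, pow_succ, mul_comm]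
  refine ⟨⟨L - Nat.clog 2 #N, by omega⟩, card_le_eight_mul_card_filter_card_eq_one N
    (by positivity) (Nat.pow_le_pow_right two_pos (by simp only; omega)) ?_ ?_⟩
  · rw [hsplit]; gcongr
  · rw [hsplit]
    calc 2 * (2 ^ Nat.clog 2 #N * 2 ^ (L - Nat.clog 2 #N))
        ≤ 2 * (2 * #N * 2 ^ (L - Nat.clog 2 #N)) := by gcongr
      _ = _ := by ring

/-! ### Answers in terms of neighbourhoods -/

/-- The answer of a graph `G` to a query, in combinatorial form: the vertices outside the queried
set that have a neighbour in it. -/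
noncomputable def neighborOracle {V : Type u} (G : SimpleGraph V) (q : V → Bool) : V → Bool :=
  open scoped Classical in fun v => decide (∃ u, q u = true ∧ G.Adj v u) && !q v

theorem neighborOracle_eq_true {V : Type u} {G : SimpleGraph V} {q : V → Bool} {v : V} :
    neighborOracle G q v = true ↔ (∃ u, q u = true ∧ G.Adj v u) ∧ q v = false := by
  simp [neighborOracle]

theorem masterAnswer_adjMatrix {V : Type u} [Fintype V] [DecidableEq V] (G : WeightedGraph V) :
    masterAnswer G.adjMatrix = neighborOracle G.toSimpleGraph := by
  have hnn (i j : V) : 0 ≤ G.adjMatrix i j := by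
    simp only [WeightedGraph.adjMatrix, Matrix.of_apply]
    split_ifs
    · exact le_rfl
    · exact G.nonneg _
  have hpos (i j : V) : 0 < G.adjMatrix i j ↔ G.toSimpleGraph.Adj i j := by
    simp only [WeightedGraph.adjMatrix, Matrix.of_apply, WeightedGraph.toSimpleGraph,
      SimpleGraph.fromEdgeSet_adj, WeightedGraph.edges, Set.mem_ofPred_eq]
    by_cases hij : i = j
    · simp [hij]
    · simp [hij]
  have hterm (q : V → Bool) (i j : V) : 0 ≤ G.adjMatrix i j * boolVec q j :=
    mul_nonneg (hnn i j) (by unfold boolVec; split_ifs <;> simp)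
  funext q i
  rw [Bool.eq_iff_iff, neighborOracle_eq_true]
  simp only [masterAnswer, Bool.and_eq_true, decide_eq_true_eq, Bool.not_eq_true',
    Matrix.mulVec, dotProduct]
  refine and_congr_left fun _ => ?_
  rw [Finset.sum_pos_iff_of_nonneg fun j _ => hterm q i j]
  refine exists_congr fun j => ?_
  rw [← hpos i j]
  by_cases hj : q j = true <;> simp [boolVec, hj]

/-! ### Non-adaptive batches of queries -/

namespace QueryAlg

variable {V O : Type u}

/-- Make the queries of a list one after the other, without adapting, and continue with the
collected answers. The answers form a function that is `false` everywhere off the list. -/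
def askAll [DecidableEq (V → Bool)] :
    List (V → Bool) → (((V → Bool) → V → Bool) → QueryAlg V O) → QueryAlg V O
  | [], next => next fun _ _ => false
  | q :: qs, next => query q fun a => askAll qs fun f => next (Function.update f q a)

/-- The answers of `oracle` to the queries of a list, as collected by `QueryAlg.askAll`. -/
def answersOn [DecidableEq (V → Bool)] (oracle : (V → Bool) → V → Bool)
    (qs : List (V → Bool)) : (V → Bool) → V → Bool :=
  fun q => if q ∈ qs then oracle q else fun _ => false

theorem answersOn_nil [DecidableEq (V → Bool)] (oracle : (V → Bool) → V → Bool) :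
    answersOn oracle [] = fun _ _ => false := by
  funext q; simp [answersOn]

theorem update_answersOn [DecidableEq (V → Bool)] (oracle : (V → Bool) → V → Bool)
    (q : V → Bool) (qs : List (V → Bool)) :
    Function.update (answersOn oracle qs) q (oracle q) = answersOn oracle (q :: qs) := by
  funext q'
  by_cases h : q' = q
  · subst h; simp [answersOn]
  · simp [answersOn, h]

theorem run_askAll [DecidableEq (V → Bool)] (oracle : (V → Bool) → V → Bool)
    (qs : List (V → Bool)) (next : ((V → Bool) → V → Bool) → QueryAlg V O) :
    (askAll qs next).run oracle = (next (answersOn oracle qs)).run oracle := by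
  induction qs generalizing next with
  | nil => simp [askAll, answersOn_nil]
  | cons q qs ih => simp only [askAll, run, ih, update_answersOn]

theorem numQueries_askAll [DecidableEq (V → Bool)] (oracle : (V → Bool) → V → Bool)
    (qs : List (V → Bool)) (next : ((V → Bool) → V → Bool) → QueryAlg V O) :
    (askAll qs next).numQueries oracle =
      (next (answersOn oracle qs)).numQueries oracle + qs.length := by
  induction qs generalizing next with
  | nil => simp [askAll, answersOn_nil]
  | cons q qs ih => simp only [askAll, numQueries, ih, update_answersOn, List.length_cons]; omega

end QueryAlg

/-! ### Active components and star contraction -/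

section Contraction

variable {V : Type u}

/-- A connected component of `H` is active in a graph `G` if an edge of `G` leaves it. -/
def IsActive (G H : SimpleGraph V) (c : H.ConnectedComponent) : Prop :=
  ∃ v u, H.connectedComponentMk v = c ∧ G.Adj v u ∧ H.connectedComponentMk u ≠ c

open scoped Classical in
/-- The set of components of `H` that are active in `G`. -/
noncomputable def activeComponents [Fintype V] (G H : SimpleGraph V) :
    Finset H.ConnectedComponent :=
  {c | IsActive G H c}

theorem mem_activeComponents [Fintype V] {G H : SimpleGraph V} {c : H.ConnectedComponent} :
    c ∈ activeComponents G H ↔ IsActive G H c := by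
  simp [activeComponents]

theorem reachable_iff_of_activeComponents_eq_empty [Fintype V] {G H : SimpleGraph V} (hle : H ≤ G)
    (h : activeComponents G H = ∅) (a b : V) : H.Reachable a b ↔ G.Reachable a b := by
  refine ⟨fun hr => hr.mono hle, ?_⟩
  rintro ⟨p⟩
  induction p with
  | nil => exact .refl _
  | @cons x y z hxy _ ih =>
    refine .trans ?_ ih
    by_contra hn
    have : H.connectedComponentMk x ∈ activeComponents G H :=
      mem_activeComponents.2
        ⟨x, y, rfl, hxy, fun he => hn (SimpleGraph.ConnectedComponent.exact he).symm⟩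
    simp [h] at this

open scoped Classical in
/-- Star contraction: if each component in `W` is joined in `H'` to a component outside `W`, then
every active component of `H'` contains an active component of `H` outside `W`. -/
theorem card_activeComponents_le [Fintype V] {G H H' : SimpleGraph V} (hle : H ≤ H')
    (hle' : H' ≤ G) (W : Set H.ConnectedComponent)
    (hW : ∀ c ∈ W, ∃ v u, H.connectedComponentMk v = c ∧ H'.Adj v u ∧
      H.connectedComponentMk u ∉ W) :
    (activeComponents G H').card ≤ ((activeComponents G H).filter (· ∉ W)).card := by
  have hmk {x y : V} (h : H.connectedComponentMk x = H.connectedComponentMk y) :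
      H'.connectedComponentMk x = H'.connectedComponentMk y :=
    SimpleGraph.ConnectedComponent.sound ((SimpleGraph.ConnectedComponent.exact h).mono hle)
  refine Finset.card_le_card_of_surjOn
    (SimpleGraph.ConnectedComponent.map (SimpleGraph.Hom.ofLE hle)) ?_
  intro c' hc'
  obtain ⟨v, u, rfl, hvu, hne⟩ := mem_activeComponents.1 hc'
  by_cases hc : H.connectedComponentMk v ∈ W
  · obtain ⟨x, y, hx, hxy, hy⟩ := hW _ hc
    refine ⟨H.connectedComponentMk y, ?_, ?_⟩
    · refine Finset.mem_coe.2 (Finset.mem_filter.2 ⟨mem_activeComponents.2 ?_, hy⟩)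
      exact ⟨y, x, rfl, (hle' hxy).symm, fun he => hy (he ▸ hx ▸ hc)⟩
    · exact (SimpleGraph.ConnectedComponent.sound hxy.reachable.symm).trans (hmk hx)
  · refine ⟨H.connectedComponentMk v, ?_, rfl⟩
    refine Finset.mem_coe.2 (Finset.mem_filter.2 ⟨mem_activeComponents.2 ?_, hc⟩)
    exact ⟨v, u, rfl, hvu, fun he => hne (hmk he)⟩

theorem card_activeComponents_le_card [Fintype V] (G H : SimpleGraph V) :
    (activeComponents G H).card ≤ Fintype.card V := by
  classical
  refine (Finset.card_le_univ _).trans ?_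
  exact Fintype.card_le_of_surjective H.connectedComponentMk Quot.mk_surjective

end Contraction

/-! ### One round -/

section Round

variable {V : Type u} {L : ℕ}

/-- The randomness of one round: a colour for each vertex, only used at the representatives of
components, and a hash value for each vertex. -/
abbrev Seed (V : Type u) (L : ℕ) : Type u := (V → Bool) × (V → Fin (2 ^ (L + 1)))

/-- The colour of a component is the colour of its representative. -/
noncomputable def compColor (r : V → Bool) {H : SimpleGraph V} (c : H.ConnectedComponent) : Bool :=
  r (Quot.out c)

/-- The vertices of coloured components whose hash value is below `2 ^ j`. -/
def sample (ω : Seed V L) (H : SimpleGraph V) (j : Fin (L + 1)) : Set V :=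
  {u | compColor ω.1 (H.connectedComponentMk u) = true ∧ (ω.2 u : ℕ) < 2 ^ (j : ℕ)}

/-- The query consisting of the vertices of `sample ω H j` whose `i`-th name bit is `β`; here
`b v i` is the `i`-th bit of the name of `v`. -/
noncomputable def probe (b : V → Fin L → Bool) (ω : Seed V L) (H : SimpleGraph V)
    (j : Fin (L + 1)) (i : Fin L) (β : Bool) : V → Bool :=
  open scoped Classical in fun u => decide (u ∈ sample ω H j ∧ b u i = β)

/-- All the queries of a round. -/
noncomputable def probes (b : V → Fin L → Bool) (ω : Seed V L) (H : SimpleGraph V) :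
    List (V → Bool) :=
  (Finset.univ : Finset (Fin (L + 1) × Fin L × Bool)).toList.map
    fun t => probe b ω H t.1 t.2.1 t.2.2

theorem length_probes (b : V → Fin L → Bool) (ω : Seed V L) (H : SimpleGraph V) :
    (probes b ω H).length = (L + 1) * (L * 2) := by
  simp [probes]

/-- According to the answers `f`, the vertex `v` of an uncoloured component has a neighbour in
some sample, and the name bits of its neighbours there are all those of `u`. -/
def Finds (b : V → Fin L → Bool) (f : (V → Bool) → V → Bool) (ω : Seed V L)
    (H : SimpleGraph V) (v u : V) : Prop :=
  compColor ω.1 (H.connectedComponentMk v) = false ∧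
    ∃ j, ∀ i, f (probe b ω H j i (b u i)) v = true ∧ f (probe b ω H j i (!b u i)) v = false

/-- The graph of known edges after a round with answers `f`. -/
def nextGraph (b : V → Fin L → Bool) (f : (V → Bool) → V → Bool) (ω : Seed V L)
    (H : SimpleGraph V) : SimpleGraph V :=
  H ⊔ SimpleGraph.fromRel (Finds b f ω H)

theorem nextGraph_answersOn [DecidableEq (V → Bool)] (b : V → Fin L → Bool)
    (oracle : (V → Bool) → V → Bool) (ω : Seed V L) (H : SimpleGraph V) :
    nextGraph b (QueryAlg.answersOn oracle (probes b ω H)) ω H = nextGraph b oracle ω H := by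
  have hmem (j i β) : probe b ω H j i β ∈ probes b ω H :=
    List.mem_map.2 ⟨(j, i, β), by simp, rfl⟩
  have hans (j i β) :
      QueryAlg.answersOn oracle (probes b ω H) (probe b ω H j i β) = oracle (probe b ω H j i β) :=
    if_pos (hmem j i β)
  have hfinds : Finds b (QueryAlg.answersOn oracle (probes b ω H)) ω H = Finds b oracle ω H := by
    funext v u
    simp only [Finds, hans]
  rw [nextGraph, hfinds, nextGraph]

theorem neighborOracle_probe_eq_true {G H : SimpleGraph V} {b : V → Fin L → Bool} {ω : Seed V L}
    {v : V} (hv : compColor ω.1 (H.connectedComponentMk v) = false) (j : Fin (L + 1)) (i : Fin L)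
    (β : Bool) :
    neighborOracle G (probe b ω H j i β) v = true ↔
      ∃ u ∈ sample ω H j, b u i = β ∧ G.Adj v u := by
  have hq : probe b ω H j i β v = false := by simp [probe, sample, hv]
  rw [neighborOracle_eq_true, and_iff_left hq]
  simp [probe, and_assoc]

/-- Only edges of `G` are found: the neighbours of `v` in the sample all carry the name of `u`, and
there is one. -/
theorem Finds.adj {G H : SimpleGraph V} {b : V → Fin L → Bool} (hb : Function.Injective b)
    {ω : Seed V L} {v u : V} (hne : v ≠ u) (h : Finds b (neighborOracle G) ω H v u) :
    G.Adj v u := by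
  obtain ⟨hv, j, hj⟩ := h
  -- Distinct names differ somewhere, so names have at least one bit.
  obtain ⟨i, -⟩ := Function.ne_iff.1 (hb.ne hne)
  obtain ⟨w, hws, -, hvw⟩ := (neighborOracle_probe_eq_true hv j i _).1 (hj i).1
  have hwu : w = u := by
    refine hb (funext fun i' => ?_)
    by_contra hdiff
    have := (neighborOracle_probe_eq_true (G := G) (b := b) hv j i' (!b u i')).2
      ⟨w, hws, Bool.eq_not_iff.2 hdiff, hvw⟩
    rw [(hj i').2] at this
    exact Bool.noConfusion this
  exact hwu ▸ hvw

/-- A vertex of an uncoloured component with a unique neighbour in some sample finds it. -/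
theorem finds_of_unique {G H : SimpleGraph V} {b : V → Fin L → Bool} {ω : Seed V L} {v u : V}
    (hv : compColor ω.1 (H.connectedComponentMk v) = false) {j : Fin (L + 1)}
    (hu : u ∈ sample ω H j) (hvu : G.Adj v u)
    (huniq : ∀ w ∈ sample ω H j, G.Adj v w → w = u) :
    Finds b (neighborOracle G) ω H v u := by
  refine ⟨hv, j, fun i => ⟨?_, ?_⟩⟩
  · exact (neighborOracle_probe_eq_true hv j i _).2 ⟨u, hu, rfl, hvu⟩
  · rw [← Bool.not_eq_true, neighborOracle_probe_eq_true hv]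
    rintro ⟨w, hw, hwi, hvw⟩
    rw [huniq w hw hvw] at hwi
    simp at hwi

theorem le_nextGraph (b : V → Fin L → Bool) (f : (V → Bool) → V → Bool) (ω : Seed V L)
    (H : SimpleGraph V) : H ≤ nextGraph b f ω H :=
  le_sup_left

theorem nextGraph_le {G H : SimpleGraph V} {b : V → Fin L → Bool} (hb : Function.Injective b)
    (ω : Seed V L) (hle : H ≤ G) : nextGraph b (neighborOracle G) ω H ≤ G := by
  refine sup_le hle fun v u hvu => ?_
  obtain ⟨hne, h | h⟩ := (SimpleGraph.fromRel_adj _ _ _).1 hvu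
  · exact h.adj hb hne
  · exact (h.adj hb hne.symm).symm

/-- The components that become attached to another one in a round: the uncoloured ones with a new
edge to a coloured one. -/
def attached (b : V → Fin L → Bool) (G H : SimpleGraph V) (ω : Seed V L) :
    Set H.ConnectedComponent :=
  {c | compColor ω.1 c = false ∧ ∃ v u, H.connectedComponentMk v = c ∧
    (nextGraph b (neighborOracle G) ω H).Adj v u ∧
    compColor ω.1 (H.connectedComponentMk u) = true}

open scoped Classical in
theorem card_activeComponents_nextGraph_le [Fintype V] {G H : SimpleGraph V}
    {b : V → Fin L → Bool} (hb : Function.Injective b) (ω : Seed V L) (hle : H ≤ G) :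
    (activeComponents G (nextGraph b (neighborOracle G) ω H)).card ≤
      ((activeComponents G H).filter (· ∉ attached b G H ω)).card := by
  refine card_activeComponents_le (le_nextGraph _ _ _ _) (nextGraph_le hb ω hle) _ ?_
  rintro c ⟨-, v, u, hv, hvu, hu⟩
  exact ⟨v, u, hv, hvu, fun hmem => by simp [hmem.1] at hu⟩

open scoped Classical in
open Finset in
/-- An active component is attached with probability at least `1 / 32`: with probability `1 / 4` it
is uncoloured while a fixed neighbouring component is coloured, and then one of the sampling rates
isolates a neighbour with probability at least `1 / 8`. -/
theorem card_seed_le_card_filter_mem_attached [Fintype V] {G H : SimpleGraph V}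
    (b : V → Fin L → Bool) (hL : Fintype.card V ≤ 2 ^ L) {c : H.ConnectedComponent}
    (hc : IsActive G H c) :
    Fintype.card (Seed V L) ≤ 32 * #{ω : Seed V L | c ∈ attached b G H ω} := by
  obtain ⟨v, u₀, rfl, hvu₀, hne⟩ := hc
  set x : V := Quot.out (H.connectedComponentMk v) with hx
  set y : V := Quot.out (H.connectedComponentMk u₀) with hy
  have hxy : x ≠ y := fun h => hne <| by
    have := congrArg H.connectedComponentMk h
    exact ((Quot.out_eq _).symm.trans (this.symm.trans (Quot.out_eq _)))
  have hcol : #{r : V → Bool | r x = false ∧ r y = true} * 4 = Fintype.card (V → Bool) := by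
    simpa using card_filter_apply_mem_and_apply_mem (α := Bool) hxy {false} {true}
  have hfiber : ∀ r ∈ ({r : V → Bool | r x = false ∧ r y = true} : Finset _),
      Fintype.card (V → Fin (2 ^ (L + 1))) ≤
        8 * #{h : V → Fin (2 ^ (L + 1)) | H.connectedComponentMk v ∈ attached b G H (r, h)} := by
    intro r hr
    obtain ⟨hrx, hry⟩ := (mem_filter.1 hr).2
    obtain ⟨j, hj⟩ := exists_level_card_le_eight_mul
      ({u | G.Adj v u ∧ compColor r (H.connectedComponentMk u) = true} : Finset V) (L := L)
      ⟨u₀, mem_filter.2 ⟨mem_univ _, hvu₀, hry⟩⟩ ((card_le_univ _).trans hL)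
    refine hj.trans (Nat.mul_le_mul_left 8 (card_le_card fun h hh => ?_))
    obtain ⟨u, hu⟩ := card_eq_one.1 (mem_filter.1 hh).2
    have hmem (w : V) : (G.Adj v w ∧ w ∈ sample (r, h) H j) ↔ w = u := by
      rw [← mem_singleton, ← hu]
      simp [sample, and_assoc]
    obtain ⟨hvu, hus⟩ := (hmem u).2 rfl
    have hfind : Finds b (neighborOracle G) (r, h) H v u :=
      finds_of_unique hrx hus hvu fun w hw hvw => (hmem w).1 ⟨hvw, hw⟩
    refine mem_filter.2 ⟨mem_univ _, hrx, v, u, rfl, Or.inr ?_, hus.1⟩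
    exact (SimpleGraph.fromRel_adj _ _ _).2 ⟨hvu.ne, Or.inl hfind⟩
  -- Fubini: split the count of seeds over the colouring.
  have hsum : #{ω : Seed V L | H.connectedComponentMk v ∈ attached b G H ω} =
      ∑ r : V → Bool, #{h : V → Fin (2 ^ (L + 1)) |
        H.connectedComponentMk v ∈ attached b G H (r, h)} := by
    simp only [card_filter]
    exact Fintype.sum_prod_type _
  calc Fintype.card (Seed V L)
      = 4 * ∑ r ∈ ({r : V → Bool | r x = false ∧ r y = true} : Finset _),
          Fintype.card (V → Fin (2 ^ (L + 1))) := by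
        rw [Fintype.card_prod, ← hcol, sum_const, smul_eq_mul]; ring
    _ ≤ 4 * ∑ r ∈ ({r : V → Bool | r x = false ∧ r y = true} : Finset _),
          8 * #{h : V → Fin (2 ^ (L + 1)) |
            H.connectedComponentMk v ∈ attached b G H (r, h)} := by
        gcongr with r hr
        exact hfiber r hr
    _ ≤ 4 * ∑ r : V → Bool, 8 * #{h : V → Fin (2 ^ (L + 1)) |
            H.connectedComponentMk v ∈ attached b G H (r, h)} := by
        gcongr
        exact subset_univ _
    _ = _ := by rw [hsum, ← mul_sum]; ring

open scoped Classical in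
open Finset in
/-- A round multiplies the expected number of active components by at most `31 / 32`. -/
theorem sum_card_activeComponents_nextGraph_le [Fintype V] {G H : SimpleGraph V}
    {b : V → Fin L → Bool} (hb : Function.Injective b) (hL : Fintype.card V ≤ 2 ^ L)
    (hle : H ≤ G) :
    32 * ∑ ω : Seed V L, #(activeComponents G (nextGraph b (neighborOracle G) ω H)) ≤
      31 * (Fintype.card (Seed V L) * #(activeComponents G H)) := by
  calc 32 * ∑ ω : Seed V L, #(activeComponents G (nextGraph b (neighborOracle G) ω H))
      ≤ 32 * ∑ ω : Seed V L, #{c ∈ activeComponents G H | c ∉ attached b G H ω} := by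
        gcongr with ω
        exact card_activeComponents_nextGraph_le hb ω hle
    _ = ∑ c ∈ activeComponents G H, 32 * #{ω : Seed V L | c ∉ attached b G H ω} := by
        simp only [card_filter, ← mul_sum]
        rw [sum_comm]
    _ ≤ ∑ c ∈ activeComponents G H, 31 * Fintype.card (Seed V L) := by
        refine sum_le_sum fun c hc => ?_
        have h1 := card_seed_le_card_filter_mem_attached b hL (mem_activeComponents.1 hc)
        have h2 := card_filter_add_card_filter_not (s := (univ : Finset (Seed V L)))
          (fun ω => c ∈ attached b G H ω)
        rw [card_univ] at h2
        omega
    _ = _ := by rw [sum_const, smul_eq_mul]; ring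

end Round

/-! ### The algorithm and its failure probability -/

section Algorithm

variable {V : Type u} {L : ℕ}

open scoped Classical in
/-- The edge set of a spanning forest of a graph. -/
noncomputable def spanningForestEdges [Fintype V] (H : SimpleGraph V) : Finset (Sym2 V) :=
  H.exists_isAcyclic_reachable_eq_le.choose.edgeFinset

theorem isSpanningForest_spanningForestEdges [Fintype V] (G : WeightedGraph V)
    {H : SimpleGraph V} (hle : H ≤ G.toSimpleGraph)
    (h : activeComponents G.toSimpleGraph H = ∅) :
    G.IsSpanningForest (spanningForestEdges H) := by
  classical
  obtain ⟨hFH, hacyc, hreach⟩ := H.exists_isAcyclic_reachable_eq_le.choose_spec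
  have hedges : (spanningForestEdges H : Set (Sym2 V)) =
      H.exists_isAcyclic_reachable_eq_le.choose.edgeSet := by
    simp [spanningForestEdges]
  refine ⟨?_, ?_, fun a b => ?_⟩
  · rw [hedges]
    refine (SimpleGraph.edgeSet_mono (hFH.trans hle)).trans ?_
    rw [WeightedGraph.toSimpleGraph, SimpleGraph.edgeSet_fromEdgeSet]
    exact Set.sdiff_subset
  · rwa [hedges, SimpleGraph.fromEdgeSet_edgeSet]
  · rw [hedges, SimpleGraph.fromEdgeSet_edgeSet, hreach]
    exact reachable_iff_of_activeComponents_eq_empty hle h a b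

open scoped Classical in
/-- The algorithm with `k` rounds, as a random function of the graph of edges known at its start:
in each round a fresh seed is drawn, its queries are made, and the edges found are added; at the
end a spanning forest of the known edges is returned. -/
noncomputable def forestAlg [Fintype V] (b : V → Fin L → Bool) :
    ℕ → PMF (SimpleGraph V → QueryAlg V (Finset (Sym2 V)))
  | 0 => PMF.pure fun H => .output (spanningForestEdges H)
  | k + 1 => (PMF.uniformOfFintype (Seed V L)).bind fun ω => (forestAlg b k).map fun T H =>
      QueryAlg.askAll (probes b ω H) fun f => T (nextGraph b f ω H)

theorem numQueries_forestAlg [Fintype V] (b : V → Fin L → Bool)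
    (oracle : (V → Bool) → V → Bool) (k : ℕ) :
    ∀ T ∈ (forestAlg b k).support, ∀ H : SimpleGraph V,
      (T H).numQueries oracle = k * ((L + 1) * (L * 2)) := by
  classical
  induction k with
  | zero =>
    intro T hT H
    rw [forestAlg, PMF.support_pure, Set.mem_singleton_iff] at hT
    simp [hT, QueryAlg.numQueries]
  | succ k ih =>
    intro T hT H
    rw [forestAlg, PMF.mem_support_bind_iff] at hT
    obtain ⟨ω, -, hT⟩ := hT
    rw [PMF.mem_support_map_iff] at hT
    obtain ⟨T', hT', rfl⟩ := hT
    rw [QueryAlg.numQueries_askAll, ih T' hT', length_probes]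
    ring

open scoped ENNReal in
/-- The failure probability is at most the expected number of active components left: if none is
left, a spanning forest of the known edges is one of `G`. -/
theorem toOuterMeasure_forestAlg_le [Fintype V] {b : V → Fin L → Bool}
    (hb : Function.Injective b) (hL : Fintype.card V ≤ 2 ^ L) (G : WeightedGraph V) (k : ℕ) :
    ∀ H ≤ G.toSimpleGraph,
      (forestAlg b k).toOuterMeasure
          {T | ¬ G.IsSpanningForest ((T H).run (neighborOracle G.toSimpleGraph))} ≤
        (31 / 32 : ℝ≥0∞) ^ k * (activeComponents G.toSimpleGraph H).card := by
  classical
  induction k with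
  | zero =>
    intro H hle
    rw [forestAlg, PMF.toOuterMeasure_pure_apply, pow_zero, one_mul]
    split_ifs with hbad
    · rw [Nat.one_le_cast, Nat.one_le_iff_ne_zero]
      exact fun h0 => hbad
        (isSpanningForest_spanningForestEdges G hle (Finset.card_eq_zero.1 h0))
    · exact zero_le
  | succ k ih =>
    intro H hle
    set N : ℕ := Fintype.card (Seed V L) with hN
    have hN0 : (N : ℝ≥0∞) ≠ 0 := Nat.cast_ne_zero.2 Fintype.card_ne_zero
    have hNtop : (N : ℝ≥0∞) ≠ ∞ := ENNReal.natCast_ne_top N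
    set a : Seed V L → ℕ := fun ω => (activeComponents G.toSimpleGraph
      (nextGraph b (neighborOracle G.toSimpleGraph) ω H)).card with ha
    -- The one-round bound, with its factors `32` and `31` moved to the right.
    have hround : (∑ ω, (a ω : ℝ≥0∞)) ≤
        31 / 32 * (N * (activeComponents G.toSimpleGraph H).card) := by
      rw [← ENNReal.mul_div_right_comm, ENNReal.le_div_iff_mul_le (by simp) (by simp), mul_comm]
      exact_mod_cast sum_card_activeComponents_nextGraph_le hb hL hle
    rw [forestAlg, PMF.toOuterMeasure_bind_apply, tsum_fintype]
    calc _ ≤ ∑ ω : Seed V L, (N : ℝ≥0∞)⁻¹ * ((31 / 32) ^ k * a ω) := by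
          refine Finset.sum_le_sum fun ω _ => ?_
          rw [PMF.uniformOfFintype_apply, PMF.toOuterMeasure_map_apply]
          gcongr
          refine le_trans (le_of_eq ?_) (ih _ (nextGraph_le hb ω hle))
          congr 1
          ext T
          simp only [Set.mem_preimage, Set.mem_ofPred_eq, QueryAlg.run_askAll,
            nextGraph_answersOn]
      _ = (N : ℝ≥0∞)⁻¹ * (31 / 32) ^ k * ∑ ω, (a ω : ℝ≥0∞) := by
          rw [Finset.mul_sum]
          exact Finset.sum_congr rfl fun ω _ => (mul_assoc _ _ _).symm
      _ ≤ (N : ℝ≥0∞)⁻¹ * (31 / 32) ^ k *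
            (31 / 32 * (N * (activeComponents G.toSimpleGraph H).card)) := by gcongr
      _ = ((N : ℝ≥0∞)⁻¹ * N) * ((31 / 32) ^ (k + 1) *
            (activeComponents G.toSimpleGraph H).card) := by ring
      _ = _ := by rw [ENNReal.inv_mul_cancel hN0 hNtop, one_mul]

end Algorithm

/-! ### Choice of the parameters -/

open scoped ENNReal in
/-- `96 L` rounds suffice, as `(31 / 32) ^ 96 ≤ 1 / 10`. -/
theorem pow_rounds_mul_le {L a : ℕ} (ha : a ≤ 2 ^ L) (ha0 : L = 0 → a = 0) :
    (31 / 32 : ℝ≥0∞) ^ (96 * L) * a ≤ 1 / 5 := by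
  rcases Nat.eq_zero_or_pos L with rfl | hL
  · simp [ha0 rfl]
  have hbase : ((31 : ℝ≥0∞) / 32) ^ 96 * 2 ≤ 1 / 5 := by
    have hreal : ENNReal.ofReal (((31 : ℝ) / 32) ^ 96 * 2) ≤ ENNReal.ofReal (1 / 5) :=
      ENNReal.ofReal_le_ofReal (by norm_num)
    rw [ENNReal.ofReal_mul (by positivity), ENNReal.ofReal_pow (by positivity),
      ENNReal.ofReal_div_of_pos (by norm_num), ENNReal.ofReal_div_of_pos (by norm_num)] at hreal
    simpa using hreal
  calc (31 / 32 : ℝ≥0∞) ^ (96 * L) * a ≤ (31 / 32) ^ (96 * L) * 2 ^ L := by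
        gcongr
        exact_mod_cast ha
    _ = ((31 / 32) ^ 96 * 2) ^ L := by rw [pow_mul, mul_pow]
    _ ≤ (1 / 5) ^ L := by gcongr
    _ ≤ (1 / 5) ^ 1 := pow_le_pow_of_le_one zero_le (by simp) hL
    _ = 1 / 5 := pow_one _

/-- The bound also holds for `n ≤ 1`, where both sides are `0`. -/
theorem clog_two_le_mul_log {n : ℕ} : (Nat.clog 2 n : ℝ) ≤ 4 * Real.log n := by
  rcases Nat.lt_or_ge 1 n with hn | hn
  · have hpos : 0 < Nat.clog 2 n := Nat.clog_pos one_lt_two hn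
    have hpred := Nat.pow_pred_clog_lt_self one_lt_two hn
    obtain ⟨c, hc⟩ := Nat.exists_eq_succ_of_ne_zero hpos.ne'
    rw [hc, Nat.pred_succ] at hpred
    have hlog2 := Real.log_two_gt_d9
    have h1 : (c : ℝ) * Real.log 2 ≤ Real.log n := by
      rw [← Real.log_pow]
      exact Real.log_le_log (by positivity) (by exact_mod_cast hpred.le)
    have h2 : Real.log 2 ≤ Real.log n := Real.log_le_log two_pos (by exact_mod_cast hn)
    have h3 : (c : ℝ) * (1 / 2) ≤ c * Real.log 2 := by gcongr; linarith
    rw [hc]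
    push_cast
    linarith
  · rw [Nat.clog_of_right_le_one hn]
    simpa using Real.log_natCast_nonneg n

theorem mainTheorem1 :
    ∃ C : ℝ, ∀ (V : Type u) [Fintype V] [DecidableEq V],
      ∃ P : RandQueryAlg V (Finset (Sym2 V)), ∀ G : WeightedGraph V,
        P.MakesAtMost (masterAnswer G.adjMatrix) (C * Real.log (Fintype.card V) ^ 4) ∧
        4 / 5 ≤ P.prob (masterAnswer G.adjMatrix) G.IsSpanningForest := by
  refine ⟨384 * 4 ^ 4, fun V _ _ => ?_⟩
  set L := Nat.clog 2 (Fintype.card V) with hLdef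
  have hL : Fintype.card V ≤ 2 ^ L := Nat.le_pow_clog one_lt_two _
  obtain ⟨⟨b, hb⟩⟩ : Nonempty (V ↪ (Fin L → Bool)) :=
    Function.Embedding.nonempty_of_card_le (by simpa using hL)
  refine ⟨(forestAlg b (96 * L)).map fun T => T ⊥, fun G => ⟨?_, ?_⟩⟩
  · intro T hT
    rw [PMF.mem_support_map_iff] at hT
    obtain ⟨T', hT', rfl⟩ := hT
    rw [numQueries_forestAlg b _ _ T' hT']
    have hnat : 96 * L * ((L + 1) * (L * 2)) ≤ 384 * L ^ 4 := by
      rcases Nat.eq_zero_or_pos L with h0 | h1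
      · simp [h0]
      · calc 96 * L * ((L + 1) * (L * 2)) ≤ 96 * L * ((L + L) * (L * 2)) := by gcongr; exact h1
          _ = 384 * (L ^ 3 * 1) := by ring
          _ ≤ 384 * (L ^ 3 * L) := by gcongr; exact h1
          _ = 384 * L ^ 4 := by ring
    calc ((96 * L * ((L + 1) * (L * 2)) : ℕ) : ℝ) ≤ 384 * (L : ℝ) ^ 4 := by exact_mod_cast hnat
      _ ≤ 384 * (4 * Real.log (Fintype.card V)) ^ 4 := by gcongr; exact clog_two_le_mul_log
      _ = _ := by ring
  · rw [masterAnswer_adjMatrix, RandQueryAlg.prob, PMF.toOuterMeasure_map_apply]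
    set p := forestAlg b (96 * L)
    set S : Set (SimpleGraph V → QueryAlg V (Finset (Sym2 V))) :=
      {T | G.IsSpanningForest ((T ⊥).run (neighborOracle G.toSimpleGraph))} with hS
    -- On at most one vertex no round is played, and there is no active component to begin with.
    have hfail : p.toOuterMeasure Sᶜ ≤ 1 / 5 := by
      refine (toOuterMeasure_forestAlg_le hb hL G (96 * L) ⊥ bot_le).trans
        (pow_rounds_mul_le ((card_activeComponents_le_card _ _).trans hL) fun h0 => ?_)
      have hcard : Fintype.card V ≤ 1 := by rwa [h0, pow_zero] at hL
      have : Subsingleton V := Fintype.card_le_one_iff_subsingleton.1 hcard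
      rw [Finset.card_eq_zero, Finset.eq_empty_iff_forall_notMem]
      intro c hc
      obtain ⟨v, u, -, hvu, -⟩ := mem_activeComponents.1 hc
      exact hvu.ne (Subsingleton.elim v u)
    have htotal : 1 ≤ p.toOuterMeasure S + p.toOuterMeasure Sᶜ := by
      rw [← (p.toOuterMeasure_apply_eq_one_iff (S ∪ Sᶜ)).2 (by simp)]
      exact MeasureTheory.measure_union_le _ _
    have hsum : (1 : ENNReal) = 4 / 5 + 1 / 5 := by
      rw [ENNReal.div_add_div_same]
      norm_num
      exact (ENNReal.div_self (by simp) (by simp)).symm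
    have h15 : (1 / 5 : ENNReal) ≠ ⊤ := by simp
    change 4 / 5 ≤ p.toOuterMeasure S
    refine (ENNReal.add_le_add_iff_right h15).1 ?_
    rw [← hsum]
    exact htotal.trans (add_le_add le_rfl hfail)
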